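/- Let $H,U$ be real Hilbert spaces and let $A$ be the infinitesimal generator of a strongly continuous semigroup $\{S(t)\}_{t\ge 0}$ on $H$. Let $\tfrac12<\alpha\le 1$, $b>0$, $n\ge 0$, $0=t_0<t_1<\dots<t_n\le b$, $B\in\mathcal L(U,H)$, and $D_k\in\mathcal L(H)$, $E_k\in\mathcal L(U,H)$ for $k=1,\dots,n$. For $0<\alpha<1$, $t\ge 0$ and $x\in H$ put $$\Psi_\alpha(\theta)=\sum_{m=0}^\infty\frac{(-\theta)^m}{m!\,\Gamma(-\alpha m+1-\alpha)},\qquad \mathcal S_\alpha(t)x=\int_0^\infty\Psi_\alpha(\theta)S(t^\alpha\theta)x\,d\theta,\qquad \mathcal P_\alpha(t)x=\int_0^\infty\alpha\theta\Psi_\alpha(\theta)S(t^\alpha\theta)x\,d\theta$$ (with $1/\Gamma=0$ at the poles of $\Gamma$), and put $\mathcal S_1(t)=\mathcal P_1(t)=S(t)$. On the Hilbert space $L^2([0,b],U)\times U^n$ with inner product $\int_0^b\langle u_1(s),u_2(s)\rangle\,ds+\sum_{k=1}^n\langle v_{1k},v_{2k}\rangle$ define $$\begin{aligned}\mathcal M(u,\{v_k\}_{k=1}^n)={}&\int_{t_n}^b(b-s)^{\alpha-1}\mathcal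 P_\alpha(b-s)Bu(s)\,ds\\&+\mathcal S_\alpha(b-t_n)\sum_{i=1}^n\Big[\prod_{j=n}^{i+1}(I+D_j)\mathcal S_\alpha(t_j-t_{j-1})\Big](I+D_i)\int_{t_{i-1}}^{t_i}(t_i-s)^{\alpha-1}\mathcal P_\alpha(t_i-s)Bu(s)\,ds\\&+\mathcal S_\alpha(b-t_n)\sum_{i=2}^n\Big[\prod_{j=n}^{i}(I+D_j)\mathcal S_\alpha(t_j-t_{j-1})\Big]E_{i-1}v_{i-1}+\mathcal S_\alpha(b-t_n)E_nv_n,\end{aligned}$$ where in the products the factor with the largest $j$ stands on the left, and where for $n=0$ only the first integral is present. Then all the integrals above converge (as Bochner integrals in $H$), and $\mathcal M:L^2([0,b],U)\times U^n\to H$ is linear and bounded. Moreover, for every $(u,\{v_k\})\in L^2([0,b],U)\times U^n$, the element $\mathcal M(u,\{v_k\})\in H$, regarded as a constant function on $[0,b]$, belongs to $L^2([0,b],H)$. -/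

import Mathlib

open MeasureTheory Set Filter Topology
open scoped Nat

noncomputable section

namespace FractionalImpulsive

/-- The Wright function `Ψ_α(θ) = ∑ₙ (-θ)ⁿ / (n! Γ(-αn + 1 - α))` (for `0 < α < 1`).
At a pole of `Γ` Mathlib's value is `0`, so that the summand is `0`, which is the usual
convention `1 / Γ = 0` there. -/
def wright (α θ : ℝ) : ℝ :=
  ∑' n : ℕ, (-θ) ^ n / ((n ! : ℝ) * Real.Gamma (-α * n + 1 - α))

section Semigroup

variable {H : Type*} [NormedAddCommGroup H] [InnerProductSpace ℝ H]

/-- `(S t)`, `t ≥ 0`, is a strongly continuous semigroup; the values at `t < 0` play no role. -/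
structure IsC0Semigroup (S : ℝ → H →L[ℝ] H) : Prop where
  mul : ∀ t s : ℝ, 0 ≤ t → 0 ≤ s → (S t).comp (S s) = S (t + s)
  zero : S 0 = ContinuousLinearMap.id ℝ H
  tendsto : ∀ x : H, Tendsto (fun t => S t x) (𝓝[>] 0) (𝓝 x)

/-- `A` is the infinitesimal generator of `S`: its domain consists of all `x` for which
`(S t x - x) / t` converges as `t → 0+`, and `A x` is that limit. -/
structure IsGenerator (A : H →ₗ.[ℝ] H) (S : ℝ → H →L[ℝ] H) : Prop where
  mem_domain_iff : ∀ x : H, x ∈ A.domain ↔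
    ∃ y : H, Tendsto (fun t : ℝ => t⁻¹ • (S t x - x)) (𝓝[>] 0) (𝓝 y)
  tendsto : ∀ x : A.domain,
    Tendsto (fun t : ℝ => t⁻¹ • (S t (x : H) - (x : H))) (𝓝[>] 0) (𝓝 (A x))

/-- `𝒮_α(t) x = ∫₀^∞ Ψ_α(θ) S(t^α θ) x dθ` for `α < 1`, and `𝒮_1(t) = S(t)`. -/
def solS (S : ℝ → H →L[ℝ] H) (α t : ℝ) (x : H) : H :=
  if α = 1 then S t x else ∫ θ in Ioi (0 : ℝ), wright α θ • S (t ^ α * θ) x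

/-- `𝒫_α(t) x = ∫₀^∞ α θ Ψ_α(θ) S(t^α θ) x dθ` for `α < 1`, and `𝒫_1(t) = S(t)`. -/
def solP (S : ℝ → H →L[ℝ] H) (α t : ℝ) (x : H) : H :=
  if α = 1 then S t x else ∫ θ in Ioi (0 : ℝ), (α * θ * wright α θ) • S (t ^ α * θ) x

variable {U : Type*} [NormedAddCommGroup U] [InnerProductSpace ℝ U]

/-- The integrand `s ↦ (c - s)^(α-1) 𝒫_α(c - s) B u(s)`. -/
def controlIntegrand (S : ℝ → H →L[ℝ] H) (α : ℝ) (B : U →L[ℝ] H) (c : ℝ) (u : ℝ → U)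
    (s : ℝ) : H :=
  (c - s) ^ (α - 1) • solP S α (c - s) (B (u s))

/- Indexing: `t : Fin (n + 1) → ℝ` lists `t_0, …, t_n`. An index `k : Fin n` of `D`, `E`, `v`
stands for the impulse number `k + 1`, which happens at the time `t k.succ`; the preceding time
is `t k.castSucc`. -/

/-- The ordered product `∏_{j=n}^{i+1} (I + D_j) 𝒮_α(t_j - t_{j-1})` applied to `x`
(the factor with the smallest `j` acts first), with `i`, `j` in `Fin n` as described above. -/
def impulseProd (S : ℝ → H →L[ℝ] H) (α : ℝ) {n : ℕ} (t : Fin (n + 1) → ℝ)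
    (D : Fin n → H →L[ℝ] H) (i : Fin n) (x : H) : H :=
  ((List.finRange n).filter (fun j => i < j)).foldl
    (fun y j => (ContinuousLinearMap.id ℝ H + D j) (solS S α (t j.succ - t j.castSucc) y)) x

/-- The Hilbert space `L²([0,b], U) × Uⁿ` with the inner product
`∫₀ᵇ ⟪u₁, u₂⟫ + ∑ₖ ⟪v₁ₖ, v₂ₖ⟫`. -/
abbrev ControlSpace (U : Type*) [NormedAddCommGroup U] [InnerProductSpace ℝ U] (b : ℝ) (n : ℕ) :
    Type _ :=
  WithLp 2 (Lp U 2 (volume.restrict (Icc (0 : ℝ) b)) × PiLp 2 (fun _ : Fin n => U))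

/-- The controllability operator
`ℳ(u, v) = ∫_{t_n}^b (b-s)^(α-1) 𝒫_α(b-s) B u(s) ds
  + 𝒮_α(b-t_n) ∑_{i=1}^n ∏_{j=n}^{i+1} (I+D_j) 𝒮_α(t_j-t_{j-1}) (I+D_i)
      ∫_{t_{i-1}}^{t_i} (t_i-s)^(α-1) 𝒫_α(t_i-s) B u(s) ds
  + 𝒮_α(b-t_n) ∑_{i=2}^n ∏_{j=n}^i (I+D_j) 𝒮_α(t_j-t_{j-1}) E_{i-1} v_{i-1}
  + 𝒮_α(b-t_n) E_n v_n`.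
In the third line the sum runs over `k = i - 1 = 1, …, n - 1`; the last line is written as a sum
over the only index `k = n`, so that it is absent when there is no impulse. -/
def controllabilityOp (S : ℝ → H →L[ℝ] H) (α b : ℝ) (B : U →L[ℝ] H) {n : ℕ}
    (t : Fin (n + 1) → ℝ) (D : Fin n → H →L[ℝ] H) (E : Fin n → U →L[ℝ] H)
    (w : ControlSpace U b n) : H :=
  (∫ s in (t (Fin.last n))..b, controlIntegrand S α B b w.fst s)
  + solS S α (b - t (Fin.last n))
      (∑ i : Fin n, impulseProd S α t D i ((ContinuousLinearMap.id ℝ H + D i)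
        (∫ s in (t i.castSucc)..(t i.succ), controlIntegrand S α B (t i.succ) w.fst s)))
  + solS S α (b - t (Fin.last n))
      (∑ k : Fin n with k.val + 1 < n, impulseProd S α t D k (E k (w.snd k)))
  + ∑ k : Fin n with k.val + 1 = n, solS S α (b - t (Fin.last n)) (E k (w.snd k))

end Semigroup

end FractionalImpulsive

end

/-!
The point is that `𝒮_α(t)` and `𝒫_α(t)` are averages of the semigroup `S(t ^ α θ)`, which may grow
exponentially in `θ`, so that the Wright function `Ψ_α` has to decay faster than every exponential.
The power series does not show this, and it is obtained from a contour integral. By the reflection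
formula the coefficients are `sin (π α (m + 1)) Γ(α (m + 1)) / (π m!)`, and writing these Gamma
functions as integrals gives (`wright_eq`)
`Ψ_α(θ) = π⁻¹ Im ∫ exp (σ - θ σ ^ α) σ ^ (α - 1) dσ` along the ray `arg σ = π`.
In the coordinate `z = log σ` the integrand is entire. By Cauchy's theorem
(`integral_wrightKernel_deform`) the ray may be replaced by the segment from `0` to `σ₀ > 0`, an arc
`|σ| = σ₀`, `0 ≤ arg σ ≤ β`, and the rest of the ray `arg σ = β`, where `β > π / 2` and
`α β < π / 2`. The integral over the segment is real, and on the rest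
`Re σ ^ α ≥ σ₀ ^ α cos (α β) > 0`, so that `Ψ_α(θ) = O(exp (-σ₀ ^ α cos (α β) θ))` for each `σ₀`
(`exists_abs_wright_le`).

A strongly continuous semigroup on a Banach space satisfies `‖S t‖ ≤ M exp (ω t)` by the
Banach–Steinhaus theorem and is strongly continuous on `[0, ∞)`. With the decay of `Ψ_α`, dominated
convergence shows that `𝒮_α` and `𝒫_α` are strongly continuous families of bounded operators
(`isStrongFamily_solS`, `isStrongFamily_solP`), hence uniformly bounded on compact intervals.
As `α > 1 / 2`, the factor `(c - s) ^ (α - 1)` is square integrable, and Hölder's inequality makes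
each control integral a bounded operator on `L²` (`IsStrongFamily.exists_control_clm`). The operator
`ℳ` is then a finite sum of compositions of bounded operators.
-/

noncomputable section

namespace FractionalImpulsive

/-! ### The Wright function as a contour integral -/

/-- The integrand of the Hankel-type integral of the Wright function in the logarithmic
coordinate: substituting `σ = exp z` turns `exp (σ - θ σ ^ α) σ ^ (α - 1) dσ` into
`wrightKernel α θ z dz`, which is entire in `z`, so that no branch of the power has to be chosen. -/
def wrightKernel (α θ : ℝ) (z : ℂ) : ℂ :=
  Complex.exp (Complex.exp z - θ * Complex.exp (α * z) + α * z)

theorem differentiable_wrightKernel (α θ : ℝ) : Differentiable ℂ (wrightKernel α θ) := by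
  unfold wrightKernel
  fun_prop

theorem range_exp_eq_image : Real.exp '' univ = Ioi (0 : ℝ) := by
  rw [image_univ, Real.range_exp]

theorem abs_exp_smul_eq (s c x : ℝ) :
    |Real.exp x| • (Real.exp x ^ (s - 1) * Real.exp (-c * Real.exp x ^ (1 : ℝ)))
      = Real.exp (s * x - c * Real.exp x) := by
  rw [abs_of_pos (Real.exp_pos x), smul_eq_mul, ← Real.exp_mul, Real.rpow_one, ← Real.exp_add,
    ← Real.exp_add]
  congr 1
  ring

theorem integrable_exp_mul_sub_mul_exp {s c : ℝ} (hs : 0 < s) (hc : 0 < c) :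
    Integrable (fun x : ℝ => Real.exp (s * x - c * Real.exp x)) := by
  have h := integrableOn_rpow_mul_exp_neg_mul_rpow (p := 1) (s := s - 1) (b := c)
    (by linarith) one_pos hc
  rw [← range_exp_eq_image, integrableOn_image_iff_integrableOn_abs_deriv_smul MeasurableSet.univ
    (fun x _ => (Real.hasDerivAt_exp x).hasDerivWithinAt) Real.exp_injective.injOn,
    integrableOn_univ] at h
  exact h.congr (ae_of_all _ fun x => abs_exp_smul_eq s c x)

theorem integral_exp_mul_sub_exp {s : ℝ} (hs : 0 < s) :
    ∫ x : ℝ, Real.exp (s * x - Real.exp x) = Real.Gamma s := by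
  rw [Real.Gamma_eq_integral hs, ← range_exp_eq_image,
    integral_image_eq_integral_abs_deriv_smul MeasurableSet.univ
    (fun x _ => (Real.hasDerivAt_exp x).hasDerivWithinAt) Real.exp_injective.injOn,
    setIntegral_univ]
  refine integral_congr_ae (ae_of_all _ fun x => ?_)
  have := abs_exp_smul_eq s 1 x
  rw [one_mul, neg_one_mul, Real.rpow_one, mul_comm (_ ^ _)] at this
  exact this.symm

/-- Since `α < 1`, the power `σ ^ α` with `σ = exp x` is dominated by any multiple of `σ`. -/
theorem exists_mul_exp_mul_le {α : ℝ} (hα : 0 < α) (hα1 : α < 1) (τ : ℝ) (hτ : 0 ≤ τ) :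
    ∃ C : ℝ, ∀ x : ℝ, τ * Real.exp (α * x) ≤ Real.exp x / 2 + C := by
  -- beyond `x₀` the quotient `exp (α x) / exp x` is at most `1 / (2 τ + 1)`
  set x₀ : ℝ := Real.log (2 * τ + 1) / (1 - α)
  refine ⟨τ * Real.exp (α * x₀), fun x => ?_⟩
  have h1 : 0 < 1 - α := by linarith
  rcases le_total x x₀ with h | h
  · have : Real.exp (α * x) ≤ Real.exp (α * x₀) := by gcongr
    have := mul_le_mul_of_nonneg_left this hτ
    have := Real.exp_pos x
    linarith
  · have h2 : 2 * τ + 1 ≤ Real.exp ((1 - α) * x) := by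
      rw [← Real.exp_log (show 0 < 2 * τ + 1 by linarith)]
      exact Real.exp_le_exp.2 (mul_comm x (1 - α) ▸ (div_le_iff₀ h1).1 h)
    have h3 : Real.exp x = Real.exp ((1 - α) * x) * Real.exp (α * x) := by
      rw [← Real.exp_add]; congr 1; ring
    have h4 := mul_le_mul_of_nonneg_right h2 (Real.exp_pos (α * x)).le
    have := Real.exp_pos (α * x)
    have : 0 ≤ τ * Real.exp (α * x₀) := by positivity
    rw [h3]
    linarith

theorem integrable_exp_mul_sub_exp_add {α : ℝ} (hα : 0 < α) (hα1 : α < 1) (τ : ℝ) (hτ : 0 ≤ τ) :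
    Integrable (fun x : ℝ => Real.exp (α * x - Real.exp x + τ * Real.exp (α * x))) := by
  obtain ⟨C, hC⟩ := exists_mul_exp_mul_le hα hα1 τ hτ
  refine ((integrable_exp_mul_sub_mul_exp hα (c := 1 / 2) (by norm_num)).const_mul
    (Real.exp C)).mono' (by fun_prop) (ae_of_all _ fun x => ?_)
  rw [Real.norm_of_nonneg (Real.exp_pos _).le, ← Real.exp_add]
  exact Real.exp_le_exp.2 (by linarith [hC x])

/-- The kernel on the ray `arg σ = π`, that is, on the line `Im z = π` in the logarithmic
coordinate. -/
theorem wrightKernel_add_pi (α θ x : ℝ) :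
    wrightKernel α θ (x + Real.pi * Complex.I) =
      Complex.exp (α * (x + Real.pi * Complex.I)) * (Real.exp (-Real.exp x) : ℝ) *
        Complex.exp (-θ * Complex.exp (α * (x + Real.pi * Complex.I))) := by
  unfold wrightKernel
  rw [Complex.exp_add (x : ℂ), Complex.exp_pi_mul_I]
  push_cast
  rw [← Complex.exp_add, ← Complex.exp_add]
  congr 1
  ring

theorem norm_exp_mul_add_mul_I (α x y : ℝ) :
    ‖Complex.exp (α * (x + y * Complex.I))‖ = Real.exp (α * x) := by
  rw [Complex.norm_exp]
  simp

/-- The integral of the kernel along `arg σ = π` converges absolutely, and expanding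
`exp (-θ σ ^ α)` in powers of `θ` it may be computed term by term, which gives Gamma integrals.
The interchange is dominated by `exp (|θ| |σ| ^ α)`, integrable against `exp (-|σ|)` as `α < 1`. -/
theorem hasSum_integral_wrightKernel {α : ℝ} (hα : 0 < α) (hα1 : α < 1) (θ : ℝ) :
    Integrable (fun x : ℝ => wrightKernel α θ (x + Real.pi * Complex.I)) ∧
    HasSum (fun m : ℕ => ((-θ) ^ m / (m ! : ℝ) * Real.Gamma (α * (m + 1)) : ℝ) *
        Complex.exp ((α * (m + 1) * Real.pi : ℝ) * Complex.I))
      (∫ x : ℝ, wrightKernel α θ (x + Real.pi * Complex.I)) := by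
  set w : ℝ → ℂ := fun x => Complex.exp (α * (x + Real.pi * Complex.I)) with hw
  have hwc : Continuous w := by fun_prop
  have hwn (x : ℝ) : ‖w x‖ = Real.exp (α * x) := norm_exp_mul_add_mul_I α x _
  set F : ℕ → ℝ → ℂ := fun m x => w x * (Real.exp (-Real.exp x) : ℝ) * ((-θ * w x) ^ m / (m ! : ℂ))
  set bound : ℕ → ℝ → ℝ := fun m x =>
    Real.exp (α * x - Real.exp x) * ((|θ| * Real.exp (α * x)) ^ m / (m ! : ℝ))
  have hbound (x : ℝ) : HasSum (fun m => bound m x)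
      (Real.exp (α * x - Real.exp x + |θ| * Real.exp (α * x))) := by
    rw [Real.exp_add, congrFun Real.exp_eq_exp_ℝ (|θ| * _)]
    exact (NormedSpace.expSeries_div_hasSum_exp (|θ| * Real.exp (α * x))).mul_left _
  have hFm (m : ℕ) : Continuous (F m) := by fun_prop
  have hFn (m : ℕ) (x : ℝ) : ‖F m x‖ ≤ bound m x := by
    simp only [F, bound, norm_mul, norm_div, norm_pow, norm_neg, hwn, Complex.norm_real,
      Real.norm_eq_abs, Complex.norm_natCast, Real.abs_exp]
    rw [← Real.exp_add, sub_eq_add_neg]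
  have hlim (x : ℝ) : HasSum (fun m => F m x)
      (wrightKernel α θ (x + Real.pi * Complex.I)) := by
    rw [wrightKernel_add_pi]
    have := (NormedSpace.expSeries_div_hasSum_exp (-θ * w x : ℂ)).mul_left
      (w x * (Real.exp (-Real.exp x) : ℝ))
    rwa [← Complex.exp_eq_exp_ℂ] at this
  have hint := integrable_exp_mul_sub_exp_add hα hα1 |θ| (abs_nonneg θ)
  refine ⟨?_, ?_⟩
  · refine hint.mono' ?_ (ae_of_all _ fun x => ?_)
    · exact ((differentiable_wrightKernel α θ).continuous.comp
        (by fun_prop)).aestronglyMeasurable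
    · rw [← (hbound x).tsum_eq, ← (hlim x).tsum_eq]
      have hs : Summable (fun m => ‖F m x‖) :=
        Summable.of_nonneg_of_le (fun _ => norm_nonneg _) (fun m => hFn m x) (hbound x).summable
      exact (norm_tsum_le_tsum_norm hs).trans (hs.tsum_le_tsum (fun m => hFn m x)
        (hbound x).summable)
  have key := hasSum_integral_of_dominated_convergence (μ := volume) bound
    (fun m => (hFm m).aestronglyMeasurable)
    (fun m => ae_of_all _ (hFn m)) (ae_of_all _ fun x => (hbound x).summable)
    (hint.congr (ae_of_all _ fun x => (hbound x).tsum_eq.symm)) (ae_of_all _ hlim)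
  refine key.congr_fun fun m => ?_
  have hpt (x : ℝ) : F m x = (((-θ) ^ m / (m ! : ℝ) : ℝ) *
      Complex.exp ((α * (m + 1) * Real.pi : ℝ) * Complex.I)) *
        ((Real.exp (α * (m + 1) * x - Real.exp x) : ℝ) : ℂ) := by
    simp only [F, w]
    rw [mul_pow, ← Complex.exp_nat_mul]
    push_cast
    have e : Complex.exp (α * (x + Real.pi * Complex.I)) * Complex.exp (-Complex.exp x) *
        Complex.exp (m * (α * (x + Real.pi * Complex.I))) =
        Complex.exp (α * (m + 1) * Real.pi * Complex.I) *
          Complex.exp (α * (m + 1) * x - Complex.exp x) := by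
      rw [← Complex.exp_add, ← Complex.exp_add, ← Complex.exp_add]
      congr 1
      ring
    linear_combination ((-θ : ℂ) ^ m / (m ! : ℂ)) * e
  simp_rw [hpt]
  rw [integral_const_mul, integral_complex_ofReal,
    integral_exp_mul_sub_exp (s := α * (m + 1)) (by positivity)]
  push_cast
  ring

/-- The reflection formula for `1 / Γ`, valid at the poles as well: there both sides vanish. -/
theorem one_div_Gamma_one_sub {s : ℝ} (hs : 0 < s) :
    1 / Real.Gamma (1 - s) = Real.Gamma s * Real.sin (s * Real.pi) / Real.pi := by
  have h := Real.Gamma_mul_Gamma_one_sub s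
  have hG := (Real.Gamma_pos_of_pos hs).ne'
  rw [mul_comm s]
  by_cases h0 : Real.sin (Real.pi * s) = 0
  · rw [h0, div_zero] at h
    rcases mul_eq_zero.1 h with h | h
    · exact absurd h hG
    · rw [h, h0]; simp
  · have h1 : Real.Gamma (1 - s) ≠ 0 := by
      intro h1
      rw [h1, mul_zero, eq_comm, div_eq_zero_iff] at h
      exact h.elim Real.pi_ne_zero h0
    have := Real.pi_ne_zero
    rw [eq_div_iff h0] at h
    rw [div_eq_div_iff h1 this]
    linarith

/-- The Wright function is the imaginary part of a Hankel-type integral along `arg σ = π`. -/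
theorem hasSum_wright {α : ℝ} (hα : 0 < α) (hα1 : α < 1) (θ : ℝ) :
    HasSum (fun n : ℕ => (-θ) ^ n / ((n ! : ℝ) * Real.Gamma (-α * n + 1 - α)))
      ((∫ x : ℝ, wrightKernel α θ (x + Real.pi * Complex.I)).im / Real.pi) := by
  have h := (Complex.hasSum_im (hasSum_integral_wrightKernel hα hα1 θ).2).div_const Real.pi
  refine h.congr_fun fun n => ?_
  have e := one_div_Gamma_one_sub (s := α * (n + 1)) (by positivity)
  rw [Complex.im_ofReal_mul, Complex.exp_ofReal_mul_I_im,
    show -α * n + 1 - α = 1 - α * (n + 1) by ring, mul_assoc, mul_div_assoc, ← e]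
  rw [div_mul_div_comm, mul_one]

theorem wright_eq {α : ℝ} (hα : 0 < α) (hα1 : α < 1) (θ : ℝ) :
    wright α θ = (∫ x : ℝ, wrightKernel α θ (x + Real.pi * Complex.I)).im / Real.pi :=
  (hasSum_wright hα hα1 θ).tsum_eq

theorem measurable_wright {α : ℝ} (hα : 0 < α) (hα1 : α < 1) : Measurable (wright α) := by
  refine measurable_of_tendsto_metrizable (f := fun (N : ℕ) θ => ∑ n ∈ Finset.range N,
    (-θ) ^ n / ((n ! : ℝ) * Real.Gamma (-α * n + 1 - α))) (fun N => by fun_prop) ?_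
  rw [tendsto_pi_nhds]
  intro θ
  rw [wright_eq hα hα1 θ]
  exact (hasSum_wright hα hα1 θ).tendsto_sum_nat

/-! ### Superexponential decay of the Wright function -/

theorem norm_wrightKernel (α θ x y : ℝ) :
    ‖wrightKernel α θ (x + y * Complex.I)‖ =
      Real.exp (Real.exp x * Real.cos y - θ * (Real.exp (α * x) * Real.cos (α * y)) + α * x) := by
  have e : (α : ℂ) * (x + y * Complex.I) = (α * x : ℝ) + (α * y : ℝ) * Complex.I := by
    push_cast; ring
  rw [wrightKernel, Complex.norm_exp, e, Complex.add_re, Complex.sub_re, Complex.re_ofReal_mul,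
    Complex.exp_re, Complex.exp_re]
  simp

theorem im_wrightKernel_ofReal (α θ x : ℝ) : (wrightKernel α θ x).im = 0 := by
  rw [wrightKernel]
  have e : Complex.exp x - θ * Complex.exp (α * x) + α * x =
      ((Real.exp x - θ * Real.exp (α * x) + α * x : ℝ) : ℂ) := by push_cast; rfl
  rw [e, ← Complex.ofReal_exp, Complex.ofReal_im]

theorem intervalIntegrable_wrightKernel_comp (α θ : ℝ) {g : ℝ → ℂ} (hg : Continuous g) (p q : ℝ) :
    IntervalIntegrable (fun x => wrightKernel α θ (g x)) volume p q :=
  ((differentiable_wrightKernel α θ).continuous.comp hg).intervalIntegrable _ _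

/-- Cauchy's theorem on the rectangles `[-L, a] × [0, π]` and `[a, L] × [β, π]`: the contour is
moved to the real axis up to `a`, then along a vertical segment, then to the line `Im z = β`. -/
theorem integral_wrightKernel_deform (α θ a L β : ℝ) :
    ∫ x in (-L)..L, wrightKernel α θ (x + Real.pi * Complex.I) =
      (∫ x in (-L)..a, wrightKernel α θ x)
      + Complex.I * (∫ y in (0 : ℝ)..β, wrightKernel α θ (a + y * Complex.I))
      - Complex.I * (∫ y in (0 : ℝ)..Real.pi, wrightKernel α θ ((-L : ℝ) + y * Complex.I))
      + (∫ x in a..L, wrightKernel α θ (x + β * Complex.I))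
      + Complex.I * (∫ y in β..Real.pi, wrightKernel α θ (L + y * Complex.I)) := by
  have hd := differentiable_wrightKernel α θ
  have h1 := Complex.integral_boundary_rect_eq_zero_of_differentiableOn (wrightKernel α θ)
    ((-L : ℝ) : ℂ) (a + Real.pi * Complex.I) hd.differentiableOn
  have h2 := Complex.integral_boundary_rect_eq_zero_of_differentiableOn (wrightKernel α θ)
    (a + β * Complex.I) (L + Real.pi * Complex.I) hd.differentiableOn
  simp only [Complex.add_re, Complex.add_im, Complex.mul_re, Complex.mul_im, Complex.ofReal_re,
    Complex.ofReal_im, Complex.I_re, Complex.I_im, mul_zero, mul_one, zero_mul, add_zero, zero_add,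
    sub_zero, smul_eq_mul, Complex.ofReal_zero] at h1 h2
  have s1 := intervalIntegral.integral_add_adjacent_intervals (a := -L) (b := a) (c := L)
    (intervalIntegrable_wrightKernel_comp α θ
      (g := fun x : ℝ => (x + Real.pi * Complex.I : ℂ)) (by fun_prop) _ _)
    (intervalIntegrable_wrightKernel_comp α θ (by fun_prop) _ _)
  have s2 := intervalIntegral.integral_add_adjacent_intervals (a := 0) (b := β) (c := Real.pi)
    (intervalIntegrable_wrightKernel_comp α θ
      (g := fun y : ℝ => (a + y * Complex.I : ℂ)) (by fun_prop) _ _)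
    (intervalIntegrable_wrightKernel_comp α θ (by fun_prop) _ _)
  linear_combination -h1 - h2 - s1 - Complex.I * s2

/-- For each `a`, the Wright function is `O(exp (-κ σ₀ ^ α θ))` with `σ₀ = exp a` and
`κ = cos (α β)`: the part of the deformed contour on the positive half-axis contributes no imaginary
part, and on the rest `Re σ ^ α ≥ κ σ₀ ^ α`. -/
theorem abs_wright_le_aux {α : ℝ} (hα : 0 < α) (hα1 : α < 1) (a : ℝ) {β : ℝ}
    (hβ : Real.pi / 2 < β) (hβπ : β ≤ Real.pi) (hαβ : α * β < Real.pi / 2) :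
    ∃ C : ℝ, ∀ θ : ℝ, 0 ≤ θ →
      |wright α θ| ≤ C * Real.exp (-(Real.cos (α * β) * Real.exp (α * a)) * θ) := by
  have hπ := Real.pi_pos
  have hβ0 : 0 < β := by linarith
  set κ := Real.cos (α * β) with hκ
  have hκ0 : 0 < κ := Real.cos_pos_of_mem_Ioo ⟨by have := mul_pos hα hβ0; linarith, hαβ⟩
  set c := -Real.cos β with hc
  have hc0 : 0 < c := by
    have := Real.cos_neg_of_pi_div_two_lt_of_lt hβ (by linarith)
    linarith
  have hM := integrable_exp_mul_sub_mul_exp hα hc0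
  set M := ∫ x : ℝ, Real.exp (α * x - c * Real.exp x) with hMdef
  refine ⟨(β * Real.exp (Real.exp a + α * a) + M) / Real.pi, fun θ hθ => ?_⟩
  set X := Real.exp (-(κ * Real.exp (α * a)) * θ) with hX
  set e2 : ℝ → ℝ := fun L => Real.pi * Real.exp (1 + θ - α * L) with he2
  obtain ⟨C₁, hC₁⟩ := exists_mul_exp_mul_le hα hα1 ((θ + 1) / c) (by positivity)
  set e4 : ℝ → ℝ := fun L => Real.pi * Real.exp (c * C₁ - c / 2 * Real.exp L) with he4
  -- on the vertical segment
  have t1 : ‖∫ y in (0 : ℝ)..β, wrightKernel α θ (a + y * Complex.I)‖ ≤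
      β * Real.exp (Real.exp a + α * a) * X := by
    have := intervalIntegral.norm_integral_le_of_norm_le_const (a := 0) (b := β)
      (f := fun y : ℝ => wrightKernel α θ (a + y * Complex.I))
      (C := Real.exp (Real.exp a + α * a) * X) (fun y hy => ?_)
    · rw [sub_zero, abs_of_pos hβ0] at this
      linarith
    · rw [uIoc_of_le hβ0.le] at hy
      rw [norm_wrightKernel, hX, ← Real.exp_add]
      refine Real.exp_le_exp.2 ?_
      have hcos : κ ≤ Real.cos (α * y) := by
        refine Real.cos_le_cos_of_nonneg_of_le_pi (mul_pos hα hy.1).le (by linarith) ?_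
        exact mul_le_mul_of_nonneg_left hy.2 hα.le
      have i1 := mul_le_mul_of_nonneg_left (Real.cos_le_one y) (Real.exp_pos a).le
      have i2 := mul_le_mul_of_nonneg_left
        (mul_le_mul_of_nonneg_left hcos (Real.exp_pos (α * a)).le) hθ
      linarith
  have t2 (L : ℝ) (hL : 0 ≤ L) :
      ‖∫ y in (0 : ℝ)..Real.pi, wrightKernel α θ ((-L : ℝ) + y * Complex.I)‖ ≤ e2 L := by
    have := intervalIntegral.norm_integral_le_of_norm_le_const (a := 0) (b := Real.pi)
      (f := fun y : ℝ => wrightKernel α θ ((-L : ℝ) + y * Complex.I))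
      (C := Real.exp (1 + θ - α * L)) (fun y _ => ?_)
    · rw [sub_zero, abs_of_pos hπ] at this
      linarith
    · rw [norm_wrightKernel]
      refine Real.exp_le_exp.2 ?_
      have i1 := mul_le_mul_of_nonneg_left (Real.cos_le_one y) (Real.exp_pos (-L)).le
      have i2 := mul_le_mul_of_nonneg_left (mul_le_mul_of_nonneg_left
        (Real.neg_one_le_cos (α * y)) (Real.exp_pos (α * -L)).le) hθ
      have i3 : Real.exp (-L) ≤ 1 := Real.exp_le_one_iff.2 (by linarith)
      have i4 : Real.exp (α * -L) ≤ 1 := Real.exp_le_one_iff.2 (by nlinarith)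
      have i5 := mul_le_mul_of_nonneg_left i4 hθ
      linarith
  -- on the line `Im z = β`
  have t3 (L : ℝ) (hL : a ≤ L) :
      ‖∫ x in a..L, wrightKernel α θ (x + β * Complex.I)‖ ≤ M * X := by
    have i1 : ∀ x ∈ Ioc a L, ‖wrightKernel α θ (x + β * Complex.I)‖ ≤
        Real.exp (α * x - c * Real.exp x) * X := by
      intro x hx
      rw [norm_wrightKernel, hX, ← Real.exp_add]
      refine Real.exp_le_exp.2 ?_
      have i2 : Real.exp (α * a) ≤ Real.exp (α * x) :=
        Real.exp_le_exp.2 (mul_le_mul_of_nonneg_left hx.1.le hα.le)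
      have i3 := mul_le_mul_of_nonneg_left (mul_le_mul_of_nonneg_right i2 hκ0.le) hθ
      simp only [hc]
      linarith
    refine (intervalIntegral.norm_integral_le_of_norm_le hL (ae_of_all _ i1)
      (hM.mul_const X).intervalIntegrable).trans ?_
    rw [intervalIntegral.integral_of_le hL, ← integral_mul_const]
    exact setIntegral_le_integral (hM.mul_const X) (ae_of_all _ fun x => by positivity)
  have t4 (L : ℝ) :
      ‖∫ y in β..Real.pi, wrightKernel α θ (L + y * Complex.I)‖ ≤ e4 L := by
    have := intervalIntegral.norm_integral_le_of_norm_le_const (a := β) (b := Real.pi)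
      (f := fun y : ℝ => wrightKernel α θ (L + y * Complex.I))
      (C := Real.exp (c * C₁ - c / 2 * Real.exp L)) (fun y hy => ?_)
    · refine this.trans ?_
      rw [abs_of_nonneg (by linarith), mul_comm]
      exact mul_le_mul_of_nonneg_right (by linarith) (Real.exp_pos _).le
    · rw [uIoc_of_le hβπ] at hy
      rw [norm_wrightKernel]
      refine Real.exp_le_exp.2 ?_
      have hcos : Real.cos y ≤ Real.cos β :=
        Real.cos_le_cos_of_nonneg_of_le_pi hβ0.le hy.2 hy.1.le
      have i1 := mul_le_mul_of_nonneg_left hcos (Real.exp_pos L).le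
      have i2 := mul_le_mul_of_nonneg_left (mul_le_mul_of_nonneg_left
        (Real.neg_one_le_cos (α * y)) (Real.exp_pos (α * L)).le) hθ
      have i3 := mul_le_mul_of_nonneg_left (hC₁ L) hc0.le
      rw [← mul_assoc, mul_div_cancel₀ _ hc0.ne'] at i3
      have i4 := Real.add_one_le_exp (α * L)
      simp only [hc] at i3 ⊢
      linarith
  have hlim1 := (Complex.continuous_im.tendsto _).comp (intervalIntegral_tendsto_integral
    (hasSum_integral_wrightKernel hα hα1 θ).1 tendsto_neg_atTop_atBot tendsto_id)
  have h2lim : Tendsto e2 atTop (𝓝 0) := by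
    rw [← mul_zero Real.pi]
    refine (Real.tendsto_exp_atBot.comp ?_).const_mul _
    exact tendsto_atBot_add_const_left _ _
      (tendsto_neg_atTop_atBot.comp (tendsto_id.const_mul_atTop hα))
  have h4lim : Tendsto e4 atTop (𝓝 0) := by
    rw [← mul_zero Real.pi]
    refine (Real.tendsto_exp_atBot.comp ?_).const_mul _
    exact tendsto_atBot_add_const_left _ _ (tendsto_neg_atTop_atBot.comp
      (Real.tendsto_exp_atTop.const_mul_atTop (by linarith)))
  have hbd : ∀ᶠ L in atTop,
      |(∫ x in (-L)..L, wrightKernel α θ (x + Real.pi * Complex.I)).im| ≤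
        β * Real.exp (Real.exp a + α * a) * X + e2 L + M * X + e4 L := by
    filter_upwards [eventually_ge_atTop a, eventually_ge_atTop 0] with L hLa hL0
    have h0 : (∫ x in (-L)..a, wrightKernel α θ x).im = 0 := by
      have := Complex.imCLM.intervalIntegral_comp_comm (μ := volume)
        (intervalIntegrable_wrightKernel_comp α θ Complex.continuous_ofReal (-L) a)
      simp only [Complex.imCLM_apply, im_wrightKernel_ofReal,
        intervalIntegral.integral_zero] at this
      exact this.symm
    rw [integral_wrightKernel_deform α θ a L β]
    simp only [Complex.add_im, Complex.sub_im, h0, Complex.I_mul_im, zero_add]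
    refine (abs_add_le _ _).trans (add_le_add ?_ ((Complex.abs_re_le_norm _).trans (t4 L)))
    refine (abs_add_le _ _).trans (add_le_add ?_ ((Complex.abs_im_le_norm _).trans (t3 L hLa)))
    exact (abs_sub _ _).trans (add_le_add ((Complex.abs_re_le_norm _).trans t1)
      ((Complex.abs_re_le_norm _).trans (t2 L hL0)))
  have hfin := le_of_tendsto_of_tendsto hlim1.abs
    (((h2lim.const_add (β * Real.exp (Real.exp a + α * a) * X)).add_const (M * X)).add h4lim) hbd
  rw [wright_eq hα hα1, abs_div, abs_of_pos hπ, div_mul_eq_mul_div]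
  gcongr
  linarith

/-- The Wright function decays faster than every exponential. -/
theorem exists_abs_wright_le {α : ℝ} (hα : 0 < α) (hα1 : α < 1) (ω : ℝ) :
    ∃ C : ℝ, 0 ≤ C ∧ ∀ θ : ℝ, 0 ≤ θ → |wright α θ| ≤ C * Real.exp (-ω * θ) := by
  have hπ := Real.pi_pos
  -- any angle `β` with `π / 2 < β < π / (2 α)`, `β ≤ π` will do
  have h1 : α * (Real.pi / (1 + α)) < Real.pi / 2 := by
    rw [mul_div_assoc', div_lt_div_iff₀ (by linarith) two_pos]
    nlinarith
  have hκ : 0 < Real.cos (α * (Real.pi / (1 + α))) :=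
    Real.cos_pos_of_mem_Ioo
      ⟨by have : 0 < α * (Real.pi / (1 + α)) := by positivity
          linarith, h1⟩
  set κ := Real.cos (α * (Real.pi / (1 + α)))
  obtain ⟨C, hC⟩ := abs_wright_le_aux hα hα1 (Real.log ((|ω| + 1) / κ) / α)
    (β := Real.pi / (1 + α)) (by gcongr; linarith) (div_le_self hπ.le (by linarith)) h1
  have e : κ * Real.exp (α * (Real.log ((|ω| + 1) / κ) / α)) = |ω| + 1 := by
    rw [mul_div_cancel₀ _ hα.ne', Real.exp_log (by positivity), mul_div_cancel₀ _ hκ.ne']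
  rw [e] at hC
  refine ⟨|C|, abs_nonneg C, fun θ hθ => (hC θ hθ).trans ?_⟩
  refine mul_le_mul (le_abs_self C) (Real.exp_le_exp.2 ?_) (Real.exp_pos _).le (abs_nonneg C)
  have := le_abs_self ω
  nlinarith

/-! ### Strongly continuous semigroups -/

variable {H : Type*} [NormedAddCommGroup H] [InnerProductSpace ℝ H]

theorem IsC0Semigroup.tendsto_nhdsGE {S : ℝ → H →L[ℝ] H} (hS : IsC0Semigroup S) (x : H) :
    Tendsto (fun t => S t x) (𝓝[≥] 0) (𝓝 x) := by
  rw [← Ioi_insert, nhdsWithin_insert, tendsto_sup]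
  refine ⟨tendsto_pure_left.2 fun s hs => ?_, hS.tendsto x⟩
  rw [hS.zero]
  exact mem_of_mem_nhds hs

theorem IsC0Semigroup.exists_norm_le_near_zero [CompleteSpace H] {S : ℝ → H →L[ℝ] H}
    (hS : IsC0Semigroup S) :
    ∃ δ : ℝ, 0 < δ ∧ ∃ M : ℝ, 1 ≤ M ∧ ∀ t, 0 ≤ t → t ≤ δ → ‖S t‖ ≤ M := by
  by_contra! hcon
  -- otherwise the norms blow up along a sequence `u n → 0`, against Banach–Steinhaus
  have hcon' (n : ℕ) : ∃ t : ℝ, 0 ≤ t ∧ t ≤ 1 / ((n : ℝ) + 1) ∧ (n : ℝ) + 1 < ‖S t‖ :=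
    hcon _ Nat.one_div_pos_of_nat _ (by linarith [n.cast_nonneg (α := ℝ)])
  choose u hu0 hu1 hu2 using hcon'
  have hlim : Tendsto u atTop (𝓝[≥] 0) :=
    tendsto_nhdsWithin_iff.2 ⟨squeeze_zero hu0 hu1 tendsto_one_div_add_atTop_nhds_zero_nat,
      Eventually.of_forall hu0⟩
  obtain ⟨C, hC⟩ := banach_steinhaus (g := fun n => S (u n)) fun x => by
    obtain ⟨C, hC⟩ := ((hS.tendsto_nhdsGE x).comp hlim).norm.bddAbove_range
    exact ⟨C, fun n => hC ⟨n, rfl⟩⟩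
  obtain ⟨n, hn⟩ := exists_nat_gt C
  linarith [hC n, hu2 n]

theorem IsC0Semigroup.exists_norm_le_exp [CompleteSpace H] {S : ℝ → H →L[ℝ] H}
    (hS : IsC0Semigroup S) :
    ∃ M ω : ℝ, 0 ≤ M ∧ 0 ≤ ω ∧ ∀ t, 0 ≤ t → ‖S t‖ ≤ M * Real.exp (ω * t) := by
  obtain ⟨δ, hδ, M, hM, hb⟩ := hS.exists_norm_le_near_zero
  have hM0 : 0 < M := by linarith
  have key (n : ℕ) : ∀ r, 0 ≤ r → r ≤ δ → ‖S (n * δ + r)‖ ≤ M * M ^ n := by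
    induction n with
    | zero => intro r h0 h1; simpa using hb r h0 h1
    | succ n ih =>
      intro r h0 h1
      have e : ((n + 1 : ℕ) : ℝ) * δ + r = δ + (n * δ + r) := by push_cast; ring
      rw [e, ← hS.mul _ _ hδ.le (by positivity), pow_succ']
      calc _ ≤ ‖S δ‖ * ‖S (n * δ + r)‖ := ContinuousLinearMap.opNorm_comp_le _ _
        _ ≤ M * (M * M ^ n) :=
          mul_le_mul (hb δ hδ.le le_rfl) (ih r h0 h1) (norm_nonneg _) hM0.le
  refine ⟨M, Real.log M / δ, hM0.le, div_nonneg (Real.log_nonneg hM) hδ.le, fun t ht => ?_⟩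
  have h1 := Nat.floor_le (div_nonneg ht hδ.le)
  have h2 := (Nat.lt_floor_add_one (t / δ)).le
  have h3 := (le_div_iff₀ hδ).1 h1
  have h4 := (div_le_iff₀ hδ).1 h2
  have h5 := key ⌊t / δ⌋₊ (t - ⌊t / δ⌋₊ * δ) (by linarith) (by linarith)
  rw [add_sub_cancel] at h5
  refine h5.trans (mul_le_mul_of_nonneg_left ?_ hM0.le)
  rw [← Real.exp_log (pow_pos hM0 _), Real.log_pow]
  refine Real.exp_le_exp.2 ?_
  have := mul_le_mul_of_nonneg_right h1 (Real.log_nonneg hM)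
  refine this.trans (le_of_eq ?_)
  ring

theorem IsC0Semigroup.continuousOn [CompleteSpace H] {S : ℝ → H →L[ℝ] H}
    (hS : IsC0Semigroup S) (x : H) : ContinuousOn (fun t => S t x) (Ici 0) := by
  obtain ⟨M, ω, hM, hω, hb⟩ := hS.exists_norm_le_exp
  intro r hr
  have hr' : 0 ≤ r := hr
  refine tendsto_iff_norm_sub_tendsto_zero.2 ?_
  have habs : Tendsto (fun t : ℝ => |t - r|) (𝓝[Ici 0] r) (𝓝[≥] 0) := by
    refine tendsto_nhdsWithin_iff.2 ⟨?_, Eventually.of_forall fun t => abs_nonneg (t - r)⟩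
    have : Continuous fun t : ℝ => |t - r| := by fun_prop
    simpa using (this.tendsto r).mono_left nhdsWithin_le_nhds
  have hlim := (tendsto_iff_norm_sub_tendsto_zero.1
    ((hS.tendsto_nhdsGE x).comp habs)).const_mul (M * Real.exp (ω * r))
  rw [mul_zero] at hlim
  refine squeeze_zero' (Eventually.of_forall fun t => norm_nonneg _) ?_ hlim
  filter_upwards [self_mem_nhdsWithin] with t ht
  have ht' : 0 ≤ t := ht
  -- factor out `S (min r t)`, whose norm is controlled from either side of `r`
  have hfac (p q : ℝ) (hp : 0 ≤ p) (hpr : p ≤ r) (hpq : p ≤ q) :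
      ‖S q x - S p x‖ ≤ M * Real.exp (ω * r) * ‖S (q - p) x - x‖ := by
    have e : S q x - S p x = S p (S (q - p) x - x) := by
      have := hS.mul p (q - p) hp (by linarith)
      rw [add_sub_cancel] at this
      rw [map_sub, ← this, ContinuousLinearMap.comp_apply]
    rw [e]
    refine (S p).le_of_opNorm_le ((hb p hp).trans ?_) _
    gcongr
  rcases le_total r t with h | h
  · simpa [abs_of_nonneg (sub_nonneg.2 h)] using hfac r t hr' le_rfl h
  · rw [norm_sub_rev]
    simpa [abs_of_nonpos (sub_nonpos.2 h)] using hfac t r ht' h h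

/-! ### Strongly continuous families of operators -/

/-- For `t ≥ 0`, `T t` is a bounded linear operator depending on `t` continuously in the strong
operator topology. -/
structure IsStrongFamily (T : ℝ → H → H) : Prop where
  exists_clm : ∀ t, 0 ≤ t → ∃ L : H →L[ℝ] H, ∀ x, T t x = L x
  continuousOn : ∀ x, ContinuousOn (fun t => T t x) (Ici 0)

theorem IsStrongFamily.exists_norm_le [CompleteSpace H] {T : ℝ → H → H} (hT : IsStrongFamily T)
    (c : ℝ) : ∃ K : NNReal, ∀ t, 0 ≤ t → t ≤ c → ∃ L : H →L[ℝ] H, (∀ x, T t x = L x) ∧ ‖L‖ ≤ K := by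
  choose! L hL using hT.exists_clm
  obtain ⟨C, hC⟩ := banach_steinhaus (g := fun t : Icc (0 : ℝ) c => L t) fun x => by
    obtain ⟨C, hC⟩ := isCompact_Icc.exists_bound_of_continuousOn
      ((hT.continuousOn x).mono (fun _ h => h.1 : Icc 0 c ⊆ Ici 0))
    exact ⟨C, fun t => by rw [← hL t t.2.1]; exact hC t t.2⟩
  exact ⟨C.toNNReal, fun t h0 hc => ⟨L t, hL t h0,
    (hC ⟨t, h0, hc⟩).trans (Real.le_coe_toNNReal C)⟩⟩

/-- The weighted averages `∫ k(θ) S(t ^ α θ) x dθ` converge if `k` decays faster than every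
exponential. -/
theorem IsC0Semigroup.integrableOn_weight [CompleteSpace H] {S : ℝ → H →L[ℝ] H}
    (hS : IsC0Semigroup S) {k : ℝ → ℝ} (hk : Measurable k)
    (hdec : ∀ ω : ℝ, ∃ C : ℝ, 0 ≤ C ∧ ∀ θ : ℝ, 0 ≤ θ → |k θ| ≤ C * Real.exp (-ω * θ))
    {r : ℝ} (hr : 0 ≤ r) (x : H) :
    IntegrableOn (fun θ => k θ • S (r * θ) x) (Ioi 0) := by
  obtain ⟨M, ω, hM, hω, hb⟩ := hS.exists_norm_le_exp
  obtain ⟨C, hC, hdec⟩ := hdec (ω * r + 1)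
  have hmeas : AEStronglyMeasurable (fun θ => k θ • S (r * θ) x) (volume.restrict (Ioi 0)) := by
    refine hk.aestronglyMeasurable.smul (ContinuousOn.aestronglyMeasurable ?_ measurableSet_Ioi)
    exact (hS.continuousOn x).comp (by fun_prop) fun θ hθ => mul_nonneg hr (le_of_lt hθ)
  refine Integrable.mono' ((exp_neg_integrableOn_Ioi 0 one_pos).const_mul (C * M * ‖x‖)) hmeas ?_
  filter_upwards [ae_restrict_mem measurableSet_Ioi] with θ hθ
  have hθ0 : 0 ≤ θ := le_of_lt hθ
  rw [norm_smul]
  calc ‖k θ‖ * ‖S (r * θ) x‖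
      ≤ (C * Real.exp (-(ω * r + 1) * θ)) * (M * Real.exp (ω * (r * θ)) * ‖x‖) :=
        mul_le_mul (hdec θ hθ0) ((S _).le_of_opNorm_le (hb _ (mul_nonneg hr hθ0)) x)
          (norm_nonneg _) (by positivity)
    _ = C * M * ‖x‖ * (Real.exp (-(ω * r + 1) * θ) * Real.exp (ω * (r * θ))) := by ring
    _ = C * M * ‖x‖ * Real.exp (-1 * θ) := by
        rw [← Real.exp_add]; congr 2; ring

theorem IsC0Semigroup.isStrongFamily_weight [CompleteSpace H] {S : ℝ → H →L[ℝ] H}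
    (hS : IsC0Semigroup S) {k : ℝ → ℝ} (hk : Measurable k)
    (hdec : ∀ ω : ℝ, ∃ C : ℝ, 0 ≤ C ∧ ∀ θ : ℝ, 0 ≤ θ → |k θ| ≤ C * Real.exp (-ω * θ))
    {α : ℝ} (hα : 0 < α) :
    IsStrongFamily (fun t x => ∫ θ in Ioi (0 : ℝ), k θ • S (t ^ α * θ) x) := by
  obtain ⟨M, ω, hM, hω, hb⟩ := hS.exists_norm_le_exp
  have hI {t : ℝ} (ht : 0 ≤ t) := fun x => hS.integrableOn_weight hk hdec (Real.rpow_nonneg ht α) x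
  -- the same dominating function serves for all `t ∈ [0, c]`
  have hdom (c : ℝ) (hc : 0 ≤ c) : ∃ C : ℝ, 0 ≤ C ∧
      ∀ t, 0 ≤ t → t ≤ c → ∀ x : H, ∀ θ ∈ Ioi (0 : ℝ),
      ‖k θ • S (t ^ α * θ) x‖ ≤ C * Real.exp (-1 * θ) * ‖x‖ := by
    obtain ⟨C, hC, hdec⟩ := hdec (ω * c ^ α + 1)
    refine ⟨C * M, by positivity, fun t ht htc x θ hθ => ?_⟩
    have hθ0 : 0 ≤ θ := le_of_lt hθ
    have htr := Real.rpow_nonneg ht α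
    have htc' : t ^ α ≤ c ^ α := Real.rpow_le_rpow ht htc hα.le
    have h1 : ‖S (t ^ α * θ)‖ ≤ M * Real.exp (ω * (c ^ α * θ)) :=
      (hb _ (by positivity)).trans (by gcongr)
    rw [norm_smul]
    calc ‖k θ‖ * ‖S (t ^ α * θ) x‖
        ≤ (C * Real.exp (-(ω * c ^ α + 1) * θ)) * (M * Real.exp (ω * (c ^ α * θ)) * ‖x‖) :=
          mul_le_mul (hdec θ hθ0) ((S _).le_of_opNorm_le h1 x) (norm_nonneg _) (by positivity)
      _ = C * M * (Real.exp (-(ω * c ^ α + 1) * θ) * Real.exp (ω * (c ^ α * θ))) * ‖x‖ := by ring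
      _ = C * M * Real.exp (-1 * θ) * ‖x‖ := by
          rw [← Real.exp_add]; congr 3; ring
  have hexp := exp_neg_integrableOn_Ioi 0 one_pos
  refine ⟨fun t ht => ?_, fun x t₀ ht₀ => ?_⟩
  · obtain ⟨C, hC, hd⟩ := hdom t ht
    let L : H →ₗ[ℝ] H :=
      { toFun := fun x => ∫ θ in Ioi (0 : ℝ), k θ • S (t ^ α * θ) x
        map_add' := fun x y => by
          simp only [map_add, smul_add]
          exact integral_add (hI ht x) (hI ht y)
        map_smul' := fun a x => by
          simp only [map_smul, RingHom.id_apply, smul_comm (k _) a]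
          exact integral_smul a _ }
    refine ⟨L.mkContinuous (∫ θ in Ioi (0 : ℝ), C * Real.exp (-1 * θ)) fun x => ?_, fun x => rfl⟩
    rw [← integral_mul_const]
    refine norm_integral_le_of_norm_le ((hexp.const_mul C).mul_const _) ?_
    filter_upwards [ae_restrict_mem measurableSet_Ioi] with θ hθ using hd t ht le_rfl x θ hθ
  · have ht₀' : 0 ≤ t₀ := ht₀
    obtain ⟨C, hC, hd⟩ := hdom (t₀ + 1) (by linarith)
    refine continuousWithinAt_of_dominated (bound := fun θ => C * Real.exp (-1 * θ) * ‖x‖) ?_ ?_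
      ((hexp.const_mul C).mul_const _) ?_
    · filter_upwards [self_mem_nhdsWithin] with t ht using (hI ht x).aestronglyMeasurable
    · filter_upwards [self_mem_nhdsWithin,
        nhdsWithin_le_nhds (Iio_mem_nhds (lt_add_one t₀))] with t ht ht1
      filter_upwards [ae_restrict_mem measurableSet_Ioi] with θ hθ using
        hd t ht (le_of_lt ht1) x θ hθ
    · filter_upwards [ae_restrict_mem measurableSet_Ioi] with θ hθ
      have hcont : ContinuousOn (fun t : ℝ => S (t ^ α * θ) x) (Ici 0) :=
        (hS.continuousOn x).comp ((continuousOn_id.rpow_const fun _ _ => Or.inr hα.le).mul_const θ)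
          fun t ht => mul_nonneg (Real.rpow_nonneg ht α) (le_of_lt hθ)
      exact (hcont t₀ ht₀).const_smul _

theorem exists_abs_mul_wright_le {α : ℝ} (hα : 0 < α) (hα1 : α < 1) (ω : ℝ) :
    ∃ C : ℝ, 0 ≤ C ∧ ∀ θ : ℝ, 0 ≤ θ → |α * θ * wright α θ| ≤ C * Real.exp (-ω * θ) := by
  obtain ⟨C, hC, h⟩ := exists_abs_wright_le hα hα1 (ω + 1)
  refine ⟨α * C, by positivity, fun θ hθ => ?_⟩
  have h1 : θ ≤ Real.exp θ := by linarith [Real.add_one_le_exp θ]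
  rw [abs_mul, abs_of_nonneg (by positivity : 0 ≤ α * θ)]
  calc α * θ * |wright α θ| ≤ α * Real.exp θ * (C * Real.exp (-(ω + 1) * θ)) := by
        gcongr
        exact h θ hθ
    _ = α * C * (Real.exp θ * Real.exp (-(ω + 1) * θ)) := by ring
    _ = α * C * Real.exp (-ω * θ) := by rw [← Real.exp_add]; congr 2; ring

theorem measurable_mul_wright {α : ℝ} (hα : 0 < α) (hα1 : α < 1) :
    Measurable fun θ => α * θ * wright α θ :=
  (measurable_id.const_mul α).mul (measurable_wright hα hα1)

theorem IsC0Semigroup.isStrongFamily [CompleteSpace H] {S : ℝ → H →L[ℝ] H}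
    (hS : IsC0Semigroup S) : IsStrongFamily (fun t x => S t x) :=
  ⟨fun t _ => ⟨S t, fun _ => rfl⟩, hS.continuousOn⟩

theorem isStrongFamily_solS [CompleteSpace H] {S : ℝ → H →L[ℝ] H}
    (hS : IsC0Semigroup S) {α : ℝ} (hα : 0 < α) (hα1 : α ≤ 1) : IsStrongFamily (solS S α) := by
  rcases hα1.eq_or_lt with rfl | h
  · convert hS.isStrongFamily using 3
    simp [solS]
  · have := hS.isStrongFamily_weight (measurable_wright hα h) (exists_abs_wright_le hα h) hα
    convert this using 3
    simp [solS, h.ne]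

theorem isStrongFamily_solP [CompleteSpace H] {S : ℝ → H →L[ℝ] H}
    (hS : IsC0Semigroup S) {α : ℝ} (hα : 0 < α) (hα1 : α ≤ 1) : IsStrongFamily (solP S α) := by
  rcases hα1.eq_or_lt with rfl | h
  · convert hS.isStrongFamily using 3
    simp [solP]
  · have := hS.isStrongFamily_weight (measurable_mul_wright hα h) (exists_abs_mul_wright_le hα h) hα
    convert this using 3
    simp [solP, h.ne]

/-! ### The controllability operator -/

/-- A strongly continuous family preserves strong measurability: on bounded time intervals
`(t, x) ↦ T t x` is jointly continuous, being equi-Lipschitz in `x`. -/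
theorem IsStrongFamily.aestronglyMeasurable_comp [CompleteSpace H] {T : ℝ → H → H}
    (hT : IsStrongFamily T) {a c : ℝ} (hac : a ≤ c) {f : ℝ → H}
    (hf : AEStronglyMeasurable f (volume.restrict (Ioc a c))) :
    AEStronglyMeasurable (fun s => T (c - s) (f s)) (volume.restrict (Ioc a c)) := by
  obtain ⟨K, hK⟩ := hT.exists_norm_le (c - a)
  -- `c - s`, clamped to `[0, c - a]`
  set p : ℝ → ℝ := fun s => max 0 (min (c - a) (c - s)) with hp
  have hp0 (s : ℝ) : 0 ≤ p s := le_max_left _ _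
  have hp1 (s : ℝ) : p s ≤ c - a := max_le (sub_nonneg.2 hac) (min_le_left _ _)
  have hG : Continuous fun z : ℝ × H => T (p z.1) z.2 := by
    refine continuous_prod_of_continuous_lipschitzWith' _ K (fun s => ?_) fun x => ?_
    · obtain ⟨L, hL, hLK⟩ := hK (p s) (hp0 s) (hp1 s)
      simp only [hL]
      exact L.lipschitz.weaken hLK
    · exact (hT.continuousOn x).comp_continuous (by fun_prop) hp0
  refine (hG.comp_aestronglyMeasurable (aestronglyMeasurable_id.prodMk hf)).congr ?_
  filter_upwards [ae_restrict_mem measurableSet_Ioc] with s hs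
  have : p s = c - s := by
    rw [hp]
    simp only
    rw [min_eq_right (by linarith [hs.1]), max_eq_right (by linarith [hs.2])]
  simp only [id, this]

/-- The singularity at `s = c` is square integrable because `2 (α - 1) > -1`. -/
theorem memLp_two_sub_rpow {α : ℝ} (hα : 1 / 2 < α) {a c : ℝ} (hac : a ≤ c) :
    MemLp (fun s : ℝ => (c - s) ^ (α - 1)) 2 (volume.restrict (Ioc a c)) := by
  have hm : Measurable fun s : ℝ => (c - s) ^ (α - 1) := by fun_prop
  rw [memLp_two_iff_integrable_sq hm.aestronglyMeasurable]
  have h : IntervalIntegrable (fun s : ℝ => (c - s) ^ (2 * (α - 1))) volume a c := by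
    have := (intervalIntegral.intervalIntegrable_rpow' (a := c - a) (b := 0)
      (r := 2 * (α - 1)) (by linarith)).comp_sub_left c
    simpa using this
  refine ((intervalIntegrable_iff_integrableOn_Ioc_of_le hac).1 h).congr ?_
  filter_upwards [ae_restrict_mem measurableSet_Ioc] with s hs
  rw [mul_comm, Real.rpow_mul (by linarith [hs.2]), Real.rpow_two]

variable {U : Type*} [NormedAddCommGroup U] [InnerProductSpace ℝ U]

/-- By Hölder's inequality, `u ↦ ∫ (c - s) ^ (α - 1) T(c - s) B u(s) ds` is a bounded linear
operator on `L²`. -/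
theorem IsStrongFamily.exists_control_clm [CompleteSpace H] {T : ℝ → H → H}
    (hT : IsStrongFamily T) {α : ℝ} (hα : 1 / 2 < α) (B : U →L[ℝ] H) {a b c : ℝ} (ha : 0 ≤ a)
    (hac : a ≤ c) (hcb : c ≤ b) :
    ∃ L : Lp U 2 (volume.restrict (Icc (0 : ℝ) b)) →L[ℝ] H,
      ∀ u : Lp U 2 (volume.restrict (Icc (0 : ℝ) b)),
        IntervalIntegrable (fun s => (c - s) ^ (α - 1) • T (c - s) (B (u s))) volume a c ∧
        ∫ s in a..c, (c - s) ^ (α - 1) • T (c - s) (B (u s)) = L u := by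
  set μ := volume.restrict (Ioc a c)
  have hμ : μ ≤ volume.restrict (Icc (0 : ℝ) b) :=
    Measure.restrict_mono (show Ioc a c ⊆ Icc 0 b from
      fun s hs => ⟨ha.trans hs.1.le, hs.2.trans hcb⟩) le_rfl
  have hw := memLp_two_sub_rpow hα hac
  obtain ⟨K, hK⟩ := hT.exists_norm_le (c - a)
  have hTu (u : Lp U 2 (volume.restrict (Icc (0 : ℝ) b))) :
      AEStronglyMeasurable (fun s => T (c - s) (B (u s))) μ :=
    hT.aestronglyMeasurable_comp hac
      (B.continuous.comp_aestronglyMeasurable ((Lp.memLp u).mono_measure hμ).1)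
  have hTn (u : Lp U 2 (volume.restrict (Icc (0 : ℝ) b))) :
      ∀ᵐ s ∂μ, ‖T (c - s) (B (u s))‖ ≤ (K * ‖B‖) * ‖u s‖ := by
    filter_upwards [ae_restrict_mem measurableSet_Ioc] with s hs
    obtain ⟨L, hL, hLK⟩ := hK (c - s) (by linarith [hs.2]) (by linarith [hs.1])
    rw [hL, mul_assoc]
    exact (L.le_of_opNorm_le hLK _).trans (by gcongr; exact B.le_opNorm _)
  have hmem (u : Lp U 2 (volume.restrict (Icc (0 : ℝ) b))) :
      MemLp (fun s => T (c - s) (B (u s))) 2 μ :=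
    ((Lp.memLp u).mono_measure hμ).of_le_mul (hTu u) (hTn u)
  have hint (u : Lp U 2 (volume.restrict (Icc (0 : ℝ) b))) :
      Integrable (fun s => (c - s) ^ (α - 1) • T (c - s) (B (u s))) μ :=
    memLp_one_iff_integrable.1 ((hmem u).smul hw)
  have hIoc : ∀ᵐ s ∂μ, s ∈ Ioc a c := ae_restrict_mem measurableSet_Ioc
  have hlin {s : ℝ} (hs : s ∈ Ioc a c) : ∃ L : H →L[ℝ] H, ∀ x, T (c - s) x = L x :=
    hT.exists_clm _ (sub_nonneg.2 hs.2)
  let L : Lp U 2 (volume.restrict (Icc (0 : ℝ) b)) →ₗ[ℝ] H :=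
    { toFun := fun u => ∫ s, (c - s) ^ (α - 1) • T (c - s) (B (u s)) ∂μ
      map_add' := fun u v => by
        rw [← integral_add (hint u) (hint v)]
        refine integral_congr_ae ?_
        filter_upwards [hIoc, (ae_mono hμ) (Lp.coeFn_add u v)] with s hs h
        obtain ⟨L, hL⟩ := hlin hs
        simp only [h, Pi.add_apply, hL, map_add, smul_add]
      map_smul' := fun r u => by
        rw [RingHom.id_apply, ← integral_smul]
        refine integral_congr_ae ?_
        filter_upwards [hIoc, (ae_mono hμ) (Lp.coeFn_smul r u)] with s hs h
        obtain ⟨L, hL⟩ := hlin hs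
        simp only [h, Pi.smul_apply, hL, map_smul, smul_comm r] }
  have hbound (u : Lp U 2 (volume.restrict (Icc (0 : ℝ) b))) :
      ‖L u‖ ≤ (eLpNorm (fun s : ℝ => (c - s) ^ (α - 1)) 2 μ *
        ENNReal.ofReal (K * ‖B‖)).toReal * ‖u‖ := by
    have h : ‖L u‖ₑ ≤ (eLpNorm (fun s : ℝ => (c - s) ^ (α - 1)) 2 μ *
        ENNReal.ofReal (K * ‖B‖)) * ‖u‖ₑ := by
      refine (enorm_integral_le_lintegral_enorm _).trans ?_
      rw [← eLpNorm_one_eq_lintegral_enorm, mul_assoc]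
      refine (eLpNorm_smul_le_mul_eLpNorm (p := 2) (q := 2) (hTu u) hw.1).trans ?_
      gcongr
      refine (eLpNorm_le_mul_eLpNorm_of_ae_le_mul (hTn u) 2).trans ?_
      rw [Lp.enorm_def]
      gcongr
    have := ENNReal.toReal_mono
      (ENNReal.mul_ne_top (ENNReal.mul_ne_top hw.2.ne ENNReal.ofReal_ne_top) enorm_ne_top) h
    rwa [ENNReal.toReal_mul, toReal_enorm, toReal_enorm] at this
  exact ⟨L.mkContinuous _ hbound, fun u =>
    ⟨(intervalIntegrable_iff_integrableOn_Ioc_of_le hac).2 (hint u),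
      intervalIntegral.integral_of_le hac⟩⟩

theorem exists_impulseProd_clm {S : ℝ → H →L[ℝ] H} {α : ℝ} (hT : IsStrongFamily (solS S α))
    {n : ℕ} {t : Fin (n + 1) → ℝ} (ht : StrictMono t) (D : Fin n → H →L[ℝ] H) (i : Fin n) :
    ∃ L : H →L[ℝ] H, ∀ x, impulseProd S α t D i x = L x := by
  unfold impulseProd
  generalize (List.finRange n).filter (fun j => i < j) = l
  induction l with
  | nil => exact ⟨ContinuousLinearMap.id ℝ H, fun x => rfl⟩
  | cons j l ih =>
    obtain ⟨L, hL⟩ := ih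
    obtain ⟨L', hL'⟩ := hT.exists_clm (t j.succ - t j.castSucc)
      (sub_nonneg.2 (ht j.castSucc_lt_succ).le)
    refine ⟨L ∘L (ContinuousLinearMap.id ℝ H + D j) ∘L L', fun x => ?_⟩
    rw [List.foldl_cons, hL, hL']
    rfl

end FractionalImpulsive

end

theorem mainTheorem8
    {H U : Type*} [NormedAddCommGroup H] [InnerProductSpace ℝ H] [CompleteSpace H]
    [NormedAddCommGroup U] [InnerProductSpace ℝ U] [CompleteSpace U]
    (A : H →ₗ.[ℝ] H) (S : ℝ → H →L[ℝ] H)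
    (hS : FractionalImpulsive.IsC0Semigroup S) (_hA : FractionalImpulsive.IsGenerator A S)
    (α : ℝ) (hα : 1 / 2 < α) (hα1 : α ≤ 1)
    (b : ℝ) (hb : 0 < b) (n : ℕ)
    (t : Fin (n + 1) → ℝ) (ht : StrictMono t) (ht0 : t 0 = 0) (htb : t (Fin.last n) ≤ b)
    (B : U →L[ℝ] H) (D : Fin n → H →L[ℝ] H) (E : Fin n → U →L[ℝ] H) :
    -- the integrals that define `𝒮_α` and `𝒫_α` converge
    (α < 1 → ∀ τ : ℝ, 0 ≤ τ → ∀ x : H,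
      IntegrableOn (fun θ : ℝ => FractionalImpulsive.wright α θ • S (τ ^ α * θ) x) (Ioi 0) ∧
      IntegrableOn (fun θ : ℝ => (α * θ * FractionalImpulsive.wright α θ) • S (τ ^ α * θ) x)
        (Ioi 0)) ∧
    -- the integrals that define `ℳ` converge
    (∀ w : FractionalImpulsive.ControlSpace U b n,
      IntervalIntegrable (FractionalImpulsive.controlIntegrand S α B b w.fst) volume
        (t (Fin.last n)) b ∧
      ∀ i : Fin n, IntervalIntegrable
        (FractionalImpulsive.controlIntegrand S α B (t i.succ) w.fst) volume
        (t i.castSucc) (t i.succ)) ∧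
    -- `ℳ` is linear and bounded
    IsBoundedLinearMap ℝ
      (FractionalImpulsive.controllabilityOp S α b B t D E :
        FractionalImpulsive.ControlSpace U b n → H) ∧
    -- each value of `ℳ`, as a constant function, is in `L²([0,b], H)`
    (∀ w : FractionalImpulsive.ControlSpace U b n,
      MemLp (fun _ : ℝ => FractionalImpulsive.controllabilityOp S α b B t D E w) 2
        (volume.restrict (Icc (0 : ℝ) b))) := by
  open FractionalImpulsive in
  have hα0 : 0 < α := by linarith
  have hfS := isStrongFamily_solS hS hα0 hα1
  have hfP := isStrongFamily_solP hS hα0 hα1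
  have htpos (j : Fin (n + 1)) : 0 ≤ t j := ht0 ▸ ht.monotone (Fin.zero_le j)
  have htle (j : Fin (n + 1)) : t j ≤ b := (ht.monotone (Fin.le_last j)).trans htb
  obtain ⟨L₀, hL₀⟩ := hfP.exists_control_clm hα B (htpos (Fin.last n)) htb le_rfl
  choose L hL using fun i : Fin n => hfP.exists_control_clm hα B (htpos i.castSucc)
    (ht i.castSucc_lt_succ).le (htle i.succ)
  obtain ⟨R, hR⟩ := hfS.exists_clm (b - t (Fin.last n)) (sub_nonneg.2 htb)
  choose Q hQ using exists_impulseProd_clm hfS ht D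
  refine ⟨fun h τ hτ x => ⟨?_, ?_⟩, fun w => ⟨(hL₀ w.fst).1, fun i => (hL i w.fst).1⟩, ?_,
    fun w => memLp_const _⟩
  · exact hS.integrableOn_weight (measurable_wright hα0 h) (exists_abs_wright_le hα0 h)
      (Real.rpow_nonneg hτ α) x
  · exact hS.integrableOn_weight (measurable_mul_wright hα0 h) (exists_abs_mul_wright_le hα0 h)
      (Real.rpow_nonneg hτ α) x
  · let fst := WithLp.fstL 2 ℝ (Lp U 2 (volume.restrict (Icc (0 : ℝ) b)))
      (PiLp 2 (fun _ : Fin n => U))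
    let snd (k : Fin n) := (PiLp.proj 2 (fun _ : Fin n => U) k : _ →L[ℝ] U) ∘L
      WithLp.sndL 2 ℝ (Lp U 2 (volume.restrict (Icc (0 : ℝ) b))) (PiLp 2 (fun _ : Fin n => U))
    let M : ControlSpace U b n →L[ℝ] H := L₀ ∘L fst
      + R ∘L (∑ i, Q i ∘L (ContinuousLinearMap.id ℝ H + D i) ∘L L i ∘L fst)
      + R ∘L (∑ k : Fin n with k.val + 1 < n, Q k ∘L E k ∘L snd k)
      + ∑ k : Fin n with k.val + 1 = n, R ∘L E k ∘L snd k
    have hM : controllabilityOp S α b B t D E = M := by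
      funext w
      simp only [controllabilityOp, controlIntegrand, hR, hQ, (hL₀ _).2, (hL _ _).2, M,
        add_apply, ContinuousLinearMap.comp_apply,
        sum_apply]
      rfl
    rw [hM]
    exact M.isBoundedLinearMap
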